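/- Let $\mathbf{L}$ be the set of formulas $\varphi ::= p \mid \bot \mid \varphi\wedge\varphi \mid \varphi\vee\varphi \mid \varphi\to\varphi \mid \Box\varphi \mid \Diamond\varphi$, where $p$ ranges over a countably infinite set of propositional variables. For $\mathsf{Ax}\subseteq\mathbf{L}$, let $\mathsf{CK}\oplus\mathsf{Ax}$ be the Hilbert calculus deriving consecutions $\Gamma\vdash\varphi$ (with $\Gamma\subseteq\mathbf{L}$ possibly infinite) by the rules: (i) $\Gamma\vdash\varphi$ if $\varphi$ is a substitution instance of an axiom of intuitionistic propositional logic, of $\mathsf{K}_\Box: \Box(p\to q)\to(\Box p\to\Box q)$, of $\mathsf{K}_\Diamond: \Box(p\to q)\to(\Diamond p\to\Diamond q)$, or of a formula in $\mathsf{Ax}$; (ii) $\Gamma\vdash\varphi$ if $\varphi\in\Gamma$; (iii) from $\Gamma\vdash\varphi$ and $\Gamma\vdash\varphi\to\psi$ infer $\Gamma\vdash\psi$; (iv) from $\emptyset\vdash\varphi$ infer $\Gamma\vdash\Box\varphi$. Consider the axioms $$\mathsf{C}_\Diamond:\ \Diamond(p\vee q)\to\Diamond p\vee\Diamond q,\qquad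 \mathsf{I}_{\Diamond\Box}:\ (\Diamond p\to\Box q)\to\Box(p\to q),\qquad \mathsf{N}_{\Diamond\Box}:\ \Diamond\bot\to\Box\bot .$$ A $\mathsf{CK}$-frame is a tuple $(X,e,\le,R)$ where $(X,\le)$ is a preorder, $e\in X$ is such that $e\le x$ implies $x=e$, and $R$ is a binary relation on $X$ such that $eRx$ if and only if $x=e$. A valuation $V$ assigns to each propositional variable an upward closed subset of $X$ containing $e$. Satisfaction is defined by: $x\Vdash p$ iff $x\in V(p)$; $x\Vdash\bot$ iff $x=e$; $\wedge$ and $\vee$ are interpreted pointwise; $x\Vdash\varphi\to\psi$ iff for all $y\ge x$, $y\Vdash\varphi$ implies $y\Vdash\psi$; $x\Vdash\Box\varphi$ iff $z\Vdash\varphi$ for all $y,z$ with $x\le yRz$; $x\Vdash\Diamond\varphi$ iff for all $y\ge x$ there is $z$ with $yRz$ and $z\Vdash\varphi$. For a class $\mathcal{F}$ of $\mathsf{CK}$-frames, write $\Gamma\Vdash_{\mathcal{F}}\varphi$ if for every frame in $\mathcal{F}$, every valuation and every world $x$, if $x$ satisfies all formulas in $\Gamma$ then $x\Vdash\varphi$.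 A logic is sound (respectively strongly complete) with respect to $\mathcal{F}$ if for all $\Gamma\subseteq\mathbf{L}$ and $\varphi\in\mathbf{L}$, derivability of $\Gamma\vdash\varphi$ implies (respectively is implied by) $\Gamma\Vdash_{\mathcal{F}}\varphi$. Consider the following conditions on a $\mathsf{CK}$-frame. - ($\mathsf{C}_\Diamond$-suff) For every $x$ there is $x'\ge x$ such that for all $y,z$ with $x\le y$ and $x'Rz$ there is $w$ with $yRw$ and $z\le w$. - ($\mathsf{I}_{\Diamond\Box}$-suff) For all $x,y,z$ with $xRy\le z$ there is $u$ with $x\le uRz$ such that for every $s\ge u$ there is $t$ with $sRt$ and $z\le t$. - ($\mathsf{N}_{\Diamond\Box}$-corr) For every $x$, if $yRe$ for all $y\ge x$, then for all $y,z$ with $x\le yRz$ we have $z=e$. - ($\mathsf{N}_{\Diamond\Box}$-suff) For all $x,y$, if $xRe$ and $xRy$ then $y=e$. Theorem. Let $\mathsf{Ax}\subseteq\{\mathsf{C}_\Diamond,\mathsf{I}_{\Diamond\Box}\}$. Then the logic $\mathsf{CK}\oplus\mathsf{N}_{\Diamond\Box}\oplus\mathsf{Ax}$, that is $\mathsf{CK}\oplus(\mathsf{Ax}\cup\{\mathsf{N}_{\Diamond\Box}\})$,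 is sound and strongly complete with respect to the class of $\mathsf{CK}$-frames satisfying ($\mathsf{N}_{\Diamond\Box}$-corr) and ($\mathsf{A}$-suff) for each $\mathsf{A}\in\mathsf{Ax}$. Moreover, if $\mathsf{I}_{\Diamond\Box}\in\mathsf{Ax}$, then it is also sound and strongly complete with respect to the class of $\mathsf{CK}$-frames satisfying ($\mathsf{N}_{\Diamond\Box}$-suff) and ($\mathsf{A}$-suff) for each $\mathsf{A}\in\mathsf{Ax}$. -/

import Mathlib

universe u

namespace CKLogic

/-! ### Syntax -/

/-- Formulas over the countably infinite set `ℕ` of propositional variables. -/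
inductive Form : Type where
  | atom : ℕ → Form
  | bot : Form
  | conj : Form → Form → Form
  | disj : Form → Form → Form
  | imp : Form → Form → Form
  | box : Form → Form
  | dia : Form → Form

namespace Form

/-- Uniform substitution. -/
def subst (σ : ℕ → Form) : Form → Form
  | atom n => σ n
  | bot => bot
  | conj φ ψ => conj (φ.subst σ) (ψ.subst σ)
  | disj φ ψ => disj (φ.subst σ) (ψ.subst σ)
  | imp φ ψ => imp (φ.subst σ) (ψ.subst σ)
  | box φ => box (φ.subst σ)
  | dia φ => dia (φ.subst σ)

end Form

open Form

/-- The set of all substitution instances of the formulas in `Ax`. -/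
def instances (Ax : Set Form) : Set Form :=
  {φ | ∃ ψ ∈ Ax, ∃ σ : ℕ → Form, φ = ψ.subst σ}

/-! ### Axioms, written with the propositional variables `0`, `1`, `2` -/

/-- A standard axiomatisation of intuitionistic propositional logic (with modus ponens). -/
def intAxioms : Set Form :=
  { imp (atom 0) (imp (atom 1) (atom 0)),
    imp (imp (atom 0) (imp (atom 1) (atom 2)))
      (imp (imp (atom 0) (atom 1)) (imp (atom 0) (atom 2))),
    imp (conj (atom 0) (atom 1)) (atom 0),
    imp (conj (atom 0) (atom 1)) (atom 1),
    imp (atom 0) (imp (atom 1) (conj (atom 0) (atom 1))),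
    imp (atom 0) (disj (atom 0) (atom 1)),
    imp (atom 1) (disj (atom 0) (atom 1)),
    imp (imp (atom 0) (atom 2))
      (imp (imp (atom 1) (atom 2)) (imp (disj (atom 0) (atom 1)) (atom 2))),
    imp bot (atom 0) }

/-- `□(p → q) → (□p → □q)` -/
def axKBox : Form :=
  imp (box (imp (atom 0) (atom 1))) (imp (box (atom 0)) (box (atom 1)))

/-- `□(p → q) → (◇p → ◇q)` -/
def axKDia : Form :=
  imp (box (imp (atom 0) (atom 1))) (imp (dia (atom 0)) (dia (atom 1)))

/-- The axioms of the base logic `CK`. -/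
def ckAxioms : Set Form := intAxioms ∪ {axKBox, axKDia}

/-- `C◇`: `◇(p ∨ q) → ◇p ∨ ◇q` -/
def axCDia : Form :=
  imp (dia (disj (atom 0) (atom 1))) (disj (dia (atom 0)) (dia (atom 1)))

/-- `I◇□`: `(◇p → □q) → □(p → q)` -/
def axIDiaBox : Form :=
  imp (imp (dia (atom 0)) (box (atom 1))) (box (imp (atom 0) (atom 1)))

/-- `N◇□`: `◇⊥ → □⊥` -/
def axNDiaBox : Form := imp (dia bot) (box bot)

/-! ### The calculus -/

/-- `Derives Ax Γ φ`: the consecution `Γ ⊢ φ` is provable in the generalised Hilbert calculus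
`CK ⊕ Ax`. Necessitation applies only to theorems, i.e. to consecutions with empty left side. -/
inductive Derives (Ax : Set Form) : Set Form → Form → Prop where
  | ax {Γ : Set Form} {φ : Form} (h : φ ∈ instances ckAxioms ∪ instances Ax) : Derives Ax Γ φ
  | mp {Γ : Set Form} {φ ψ : Form} (h₁ : Derives Ax Γ φ) (h₂ : Derives Ax Γ (imp φ ψ)) :
      Derives Ax Γ ψ
  | nec {Γ : Set Form} {φ : Form} (h : Derives Ax ∅ φ) : Derives Ax Γ (box φ)
  | el {Γ : Set Form} {φ : Form} (h : φ ∈ Γ) : Derives Ax Γ φ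

/-! ### Relational semantics -/

/-- A `CK`-frame: a preorder with an exploding world `expl`, which has nothing above it but
itself, and a binary relation `R` such that `expl R x` holds exactly for `x = expl`. -/
structure CKFrame : Type (u + 1) where
  World : Type u
  [order : Preorder World]
  expl : World
  R : World → World → Prop
  expl_maximal : ∀ x : World, expl ≤ x → x = expl
  expl_R_iff : ∀ x : World, R expl x ↔ x = expl

attribute [instance] CKFrame.order

/-- A valuation assigns to each propositional variable an upset containing the exploding
world. -/
structure Valuation (X : CKFrame.{u}) : Type u where
  val : ℕ → Set X.World
  upset : ∀ n : ℕ, IsUpperSet (val n)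
  expl_mem : ∀ n : ℕ, X.expl ∈ val n

/-- `Forces X V x φ`: the world `x` of the model `(X, V)` satisfies `φ`. -/
def Forces (X : CKFrame.{u}) (V : Valuation X) : X.World → Form → Prop
  | x, atom n => x ∈ V.val n
  | x, bot => x = X.expl
  | x, conj φ ψ => Forces X V x φ ∧ Forces X V x ψ
  | x, disj φ ψ => Forces X V x φ ∨ Forces X V x ψ
  | x, imp φ ψ => ∀ y : X.World, x ≤ y → Forces X V y φ → Forces X V y ψ
  | x, box φ => ∀ y z : X.World, x ≤ y → X.R y z → Forces X V z φ
  | x, dia φ => ∀ y : X.World, x ≤ y → ∃ z : X.World, X.R y z ∧ Forces X V z φ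

/-- The frame `X` validates the consecution `Γ ⊢ φ`. -/
def CKFrame.Validates (X : CKFrame.{u}) (Γ : Set Form) (φ : Form) : Prop :=
  ∀ (V : Valuation X) (x : X.World), (∀ ψ ∈ Γ, Forces X V x ψ) → Forces X V x φ

/-- `Γ` semantically entails `φ` on the class `F` of frames. -/
def Entails (F : Set CKFrame.{u}) (Γ : Set Form) (φ : Form) : Prop :=
  ∀ X ∈ F, X.Validates Γ φ

/-- `CK ⊕ Ax` is sound with respect to the class `F` of frames. -/
def IsSound (Ax : Set Form) (F : Set CKFrame.{u}) : Prop :=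
  ∀ (Γ : Set Form) (φ : Form), Derives Ax Γ φ → Entails F Γ φ

/-- `CK ⊕ Ax` is strongly complete with respect to the class `F` of frames: `Γ` may be
infinite. -/
def IsStronglyComplete (Ax : Set Form) (F : Set CKFrame.{u}) : Prop :=
  ∀ (Γ : Set Form) (φ : Form), Entails F Γ φ → Derives Ax Γ φ

/-! ### Frame conditions -/

namespace CKFrame

/-- The sufficient condition for `C◇`. -/
def CDiaSuff (X : CKFrame.{u}) : Prop :=
  ∀ x : X.World, ∃ x' : X.World, x ≤ x' ∧
    ∀ y z : X.World, x ≤ y → X.R x' z → ∃ w : X.World, X.R y w ∧ z ≤ w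

/-- The sufficient condition for `I◇□`. -/
def IDiaBoxSuff (X : CKFrame.{u}) : Prop :=
  ∀ x y z : X.World, X.R x y → y ≤ z →
    ∃ u : X.World, x ≤ u ∧ X.R u z ∧
      ∀ s : X.World, u ≤ s → ∃ t : X.World, X.R s t ∧ z ≤ t

/-- The sufficient condition for `N◇□`. -/
def NDiaBoxSuff (X : CKFrame.{u}) : Prop :=
  ∀ x y : X.World, X.R x X.expl → X.R x y → y = X.expl

/-- The correspondence condition for `N◇□`. -/
def NDiaBoxCorr (X : CKFrame.{u}) : Prop :=
  ∀ x : X.World, (∀ y : X.World, x ≤ y → X.R y X.expl) →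
    ∀ y z : X.World, x ≤ y → X.R y z → z = X.expl

/-- For `Ax ⊆ {C◇, I◇□}`: the frame satisfies the sufficient condition of each axiom
in `Ax`. -/
def SatisfiesSuff (Ax : Set Form) (X : CKFrame.{u}) : Prop :=
  (axCDia ∈ Ax → X.CDiaSuff) ∧ (axIDiaBox ∈ Ax → X.IDiaBoxSuff)

end CKFrame

end CKLogic

/-! Soundness is a direct check of each axiom, since N-suff implies N-corr. Completeness uses one
canonical frame for every choice of axioms. A world is a segment: a prime theory (the head) with a
set of prime theories allowed as heads of its successors (the tail). Worlds are ordered by their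
heads alone, so the same head can be taken with a tail suited to the task: `IsTail.not_mem` refutes
a diamond, `IsTail.max` refutes a box, `IsTail.min` yields C-suff. Two tail conditions do the work.
Every theory inside `undia Γ` extends to a member, which gives the successors required by C-suff and
I-suff. Either all members are inconsistent or none is, which is exactly N-suff; the axiom N makes
the largest and smallest tails comply. With the truth lemma `forces_canonical_iff`, strong
completeness follows by extending an underivable consecution to a prime theory. -/

namespace CKLogic

open Form

/-! ### The calculus -/

section Calculus

variable {Ax Γ Δ : Set Form} {φ ψ χ : Form}

/-- The substitution sending the variables `0`, `1`, `2` to `a`, `b`, `c`. -/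
def threeSubst (a b c : Form) : ℕ → Form
  | 0 => a
  | 1 => b
  | _ => c

namespace Derives

theorem of_intAxioms (h : χ ∈ intAxioms) (a b c : Form) :
    Derives Ax Γ (χ.subst (threeSubst a b c)) :=
  .ax (.inl ⟨χ, .inl h, _, rfl⟩)

theorem of_mem_axioms (h : χ ∈ Ax) (a b c : Form) :
    Derives Ax Γ (χ.subst (threeSubst a b c)) :=
  .ax (.inr ⟨χ, h, _, rfl⟩)

theorem imp_const (a b : Form) : Derives Ax Γ (imp a (imp b a)) :=
  of_intAxioms (χ := imp (atom 0) (imp (atom 1) (atom 0))) (by simp [intAxioms]) a b a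

theorem imp_distrib (a b c : Form) :
    Derives Ax Γ (imp (imp a (imp b c)) (imp (imp a b) (imp a c))) :=
  of_intAxioms (χ := imp (imp (atom 0) (imp (atom 1) (atom 2)))
      (imp (imp (atom 0) (atom 1)) (imp (atom 0) (atom 2)))) (by simp [intAxioms]) a b c

theorem conj_left (a b : Form) : Derives Ax Γ (imp (conj a b) a) :=
  of_intAxioms (χ := imp (conj (atom 0) (atom 1)) (atom 0)) (by simp [intAxioms]) a b a

theorem conj_right (a b : Form) : Derives Ax Γ (imp (conj a b) b) :=
  of_intAxioms (χ := imp (conj (atom 0) (atom 1)) (atom 1)) (by simp [intAxioms]) a b a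

theorem conj_intro (a b : Form) : Derives Ax Γ (imp a (imp b (conj a b))) :=
  of_intAxioms (χ := imp (atom 0) (imp (atom 1) (conj (atom 0) (atom 1))))
    (by simp [intAxioms]) a b a

theorem disj_left (a b : Form) : Derives Ax Γ (imp a (disj a b)) :=
  of_intAxioms (χ := imp (atom 0) (disj (atom 0) (atom 1))) (by simp [intAxioms]) a b a

theorem disj_right (a b : Form) : Derives Ax Γ (imp b (disj a b)) :=
  of_intAxioms (χ := imp (atom 1) (disj (atom 0) (atom 1))) (by simp [intAxioms]) a b a

theorem disj_elim (a b c : Form) :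
    Derives Ax Γ (imp (imp a c) (imp (imp b c) (imp (disj a b) c))) :=
  of_intAxioms (χ := imp (imp (atom 0) (atom 2))
      (imp (imp (atom 1) (atom 2)) (imp (disj (atom 0) (atom 1)) (atom 2))))
    (by simp [intAxioms]) a b c

theorem exfalso (a : Form) : Derives Ax Γ (imp bot a) :=
  of_intAxioms (χ := imp bot (atom 0)) (by simp [intAxioms]) a a a

theorem kBox (a b : Form) : Derives Ax Γ (imp (box (imp a b)) (imp (box a) (box b))) :=
  .ax (.inl ⟨axKBox, .inr (by simp), threeSubst a b a, rfl⟩)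

theorem kDia (a b : Form) : Derives Ax Γ (imp (box (imp a b)) (imp (dia a) (dia b))) :=
  .ax (.inl ⟨axKDia, .inr (by simp), threeSubst a b a, rfl⟩)

theorem imp_self (a : Form) : Derives Ax Γ (imp a a) :=
  .mp (imp_const a a) (.mp (imp_const a (imp a a)) (imp_distrib a (imp a a) a))

theorem weaken_imp (a : Form) (h : Derives Ax Γ φ) : Derives Ax Γ (imp a φ) :=
  .mp h (imp_const φ a)

theorem imp_mp (h₁ : Derives Ax Γ (imp χ φ)) (h₂ : Derives Ax Γ (imp χ (imp φ ψ))) :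
    Derives Ax Γ (imp χ ψ) :=
  .mp h₁ (.mp h₂ (imp_distrib χ φ ψ))

theorem imp_trans (h₁ : Derives Ax Γ (imp φ ψ)) (h₂ : Derives Ax Γ (imp ψ χ)) :
    Derives Ax Γ (imp φ χ) :=
  imp_mp h₁ (weaken_imp φ h₂)

theorem dia_mono (h : Derives Ax ∅ (imp φ ψ)) : Derives Ax Γ (imp (dia φ) (dia ψ)) :=
  .mp (.nec h) (kDia φ ψ)

theorem box_mono (h : Derives Ax ∅ (imp φ ψ)) : Derives Ax Γ (imp (box φ) (box ψ)) :=
  .mp (.nec h) (kBox φ ψ)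

theorem mono (h : Derives Ax Γ φ) (hΓ : Γ ⊆ Δ) : Derives Ax Δ φ := by
  induction h with
  | ax h => exact .ax h
  | mp _ _ ih₁ ih₂ => exact .mp (ih₁ hΓ) (ih₂ hΓ)
  | nec h _ => exact .nec h
  | el h => exact .el (hΓ h)

theorem of_empty (h : Derives Ax ∅ φ) : Derives Ax Γ φ :=
  h.mono (Set.empty_subset Γ)

/-- Deduction theorem for a set `D` of premises that is directed with respect to provable
implication. -/
theorem deduction_of_directed {D : Set Form} (hne : D.Nonempty)
    (hdir : ∀ a ∈ D, ∀ b ∈ D, ∃ c ∈ D, Derives Ax ∅ (imp c a) ∧ Derives Ax ∅ (imp c b))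
    (h : Derives Ax (Γ ∪ D) φ) : ∃ d ∈ D, Derives Ax Γ (imp d φ) := by
  generalize hΔ : Γ ∪ D = Δ at h
  induction h with
  | ax h =>
    obtain ⟨d, hd⟩ := hne
    exact ⟨d, hd, weaken_imp d (.ax h)⟩
  | mp _ _ ih₁ ih₂ =>
    obtain ⟨a, ha, h₁⟩ := ih₁ hΔ
    obtain ⟨b, hb, h₂⟩ := ih₂ hΔ
    obtain ⟨c, hc, hca, hcb⟩ := hdir a ha b hb
    exact ⟨c, hc, imp_mp (imp_trans hca.of_empty h₁) (imp_trans hcb.of_empty h₂)⟩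
  | nec h _ =>
    obtain ⟨d, hd⟩ := hne
    exact ⟨d, hd, weaken_imp d (.nec h)⟩
  | el h =>
    subst hΔ
    rcases h with h | h
    · obtain ⟨d, hd⟩ := hne
      exact ⟨d, hd, weaken_imp d (.el h)⟩
    · exact ⟨_, h, imp_self _⟩

theorem deduction (h : Derives Ax (Γ ∪ {φ}) ψ) : Derives Ax Γ (imp φ ψ) := by
  obtain ⟨d, rfl, hd⟩ := deduction_of_directed (Set.singleton_nonempty φ)
    (by rintro a rfl b rfl; exact ⟨_, rfl, imp_self _, imp_self _⟩) h
  exact hd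

/-- A derivation uses finitely many premises, so one member of the chain contains them all. This
supplies the upper bounds for Zorn's lemma. -/
theorem exists_of_sUnion {c : Set (Set Form)} (hc : IsChain (· ⊆ ·) c) (hne : c.Nonempty)
    (h : Derives Ax (⋃₀ c) φ) : ∃ Δ ∈ c, Derives Ax Δ φ := by
  generalize hΔ : ⋃₀ c = Δ at h
  induction h with
  | ax h =>
    obtain ⟨Δ, hΔ⟩ := hne
    exact ⟨Δ, hΔ, .ax h⟩
  | mp _ _ ih₁ ih₂ =>
    obtain ⟨A, hA, h₁⟩ := ih₁ hΔ
    obtain ⟨B, hB, h₂⟩ := ih₂ hΔ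
    rcases hc.total hA hB with h | h
    · exact ⟨B, hB, .mp (h₁.mono h) h₂⟩
    · exact ⟨A, hA, .mp h₁ (h₂.mono h)⟩
  | nec h _ =>
    obtain ⟨Δ, hΔ⟩ := hne
    exact ⟨Δ, hΔ, .nec h⟩
  | el h =>
    subst hΔ
    obtain ⟨A, hA, h⟩ := h
    exact ⟨A, hA, .el h⟩

end Derives

/-! ### Theories -/

/-- A deductively closed set of formulas, possibly inconsistent. -/
def IsTheory (Ax Γ : Set Form) : Prop :=
  ∀ φ, Derives Ax Γ φ → φ ∈ Γ

/-- A theory with the disjunction property, possibly inconsistent. -/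
structure IsPrimeTheory (Ax Γ : Set Form) : Prop where
  isTheory : IsTheory Ax Γ
  prime : ∀ φ ψ, disj φ ψ ∈ Γ → φ ∈ Γ ∨ ψ ∈ Γ

/-- The formulas whose boxes belong to `Γ`. -/
def unbox (Γ : Set Form) : Set Form := {φ | box φ ∈ Γ}

/-- The formulas whose diamonds belong to `Γ`. -/
def undia (Γ : Set Form) : Set Form := {φ | dia φ ∈ Γ}

namespace IsTheory

theorem mem_mp (hΓ : IsTheory Ax Γ) (h : φ ∈ Γ) (hi : imp φ ψ ∈ Γ) : ψ ∈ Γ :=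
  hΓ _ (.mp (.el h) (.el hi))

theorem mem_of_derives (hΓ : IsTheory Ax Γ) (h : φ ∈ Γ) (hi : Derives Ax Γ (imp φ ψ)) : ψ ∈ Γ :=
  hΓ _ (.mp (.el h) hi)

theorem conj_mem (hΓ : IsTheory Ax Γ) : conj φ ψ ∈ Γ ↔ φ ∈ Γ ∧ ψ ∈ Γ :=
  ⟨fun h => ⟨hΓ.mem_of_derives h (.conj_left _ _), hΓ.mem_of_derives h (.conj_right _ _)⟩,
    fun h => hΓ.mem_mp h.2 (hΓ.mem_of_derives h.1 (.conj_intro _ _))⟩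

theorem eq_univ (hΓ : IsTheory Ax Γ) (h : bot ∈ Γ) : Γ = Set.univ :=
  Set.eq_univ_of_forall fun φ => hΓ.mem_of_derives h (.exfalso φ)

theorem nonempty (hΓ : IsTheory Ax Γ) : Γ.Nonempty :=
  ⟨_, hΓ _ (.imp_self bot)⟩

theorem consequences (Γ : Set Form) : IsTheory Ax {φ | Derives Ax Γ φ} := by
  intro φ h
  generalize hΔ : {φ | Derives Ax Γ φ} = Δ at h
  induction h with
  | ax h => exact hΔ ▸ .ax h
  | mp _ _ ih₁ ih₂ =>
    have h₁ := ih₁ hΔ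
    have h₂ := ih₂ hΔ
    subst hΔ
    exact .mp h₁ h₂
  | nec h _ => exact hΔ ▸ .nec h
  | el h => exact h

theorem isTheory_unbox (hΓ : IsTheory Ax Γ) : IsTheory Ax (unbox Γ) := by
  intro φ h
  generalize hΔ : unbox Γ = Δ at h
  induction h with
  | ax h => exact hΔ ▸ hΓ _ (.nec (.ax h))
  | mp _ _ ih₁ ih₂ =>
    have h₁ := ih₁ hΔ
    have h₂ := ih₂ hΔ
    subst hΔ
    exact hΓ.mem_mp h₁ (hΓ.mem_of_derives h₂ (.kBox _ _))
  | nec h _ => exact hΔ ▸ hΓ _ (.nec (.nec h))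
  | el h => exact h

theorem directed (hΓ : IsTheory Ax Γ) :
    ∀ a ∈ Γ, ∀ b ∈ Γ, ∃ c ∈ Γ, Derives Ax ∅ (imp c a) ∧ Derives Ax ∅ (imp c b) :=
  fun _ ha _ hb => ⟨_, hΓ.conj_mem.2 ⟨ha, hb⟩, .conj_left _ _, .conj_right _ _⟩

/-- Conjunctions compress the premises from `Δ` into one `d`, so `□(d → φ) ∈ Γ`, and K◇ carries `◇d`
to `◇φ`. This consistency argument underlies the tail constructions. -/
theorem dia_mem_of_derives (hΓ : IsTheory Ax Γ) (hΔ : IsTheory Ax Δ) (h : Δ ⊆ undia Γ)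
    (hφ : Derives Ax (unbox Γ ∪ Δ) φ) : dia φ ∈ Γ := by
  obtain ⟨d, hd, hdφ⟩ := Derives.deduction_of_directed hΔ.nonempty hΔ.directed hφ
  exact hΓ.mem_mp (h hd) (hΓ.mem_of_derives (hΓ.isTheory_unbox _ hdφ) (.kDia _ _))

theorem box_bot_mem (hN : axNDiaBox ∈ Ax) (hΓ : IsTheory Ax Γ) (h : dia bot ∈ Γ) : box bot ∈ Γ :=
  hΓ.mem_of_derives h (.of_mem_axioms hN bot bot bot)

end IsTheory

theorem isPrimeTheory_univ : IsPrimeTheory Ax Set.univ :=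
  ⟨fun _ _ => Set.mem_univ _, fun _ _ _ => .inl (Set.mem_univ _)⟩

/-- Prime theory lemma: underivability of all members of a set `S`, directed with respect to
provable implication, extends to a prime theory disjoint from `S`. -/
theorem exists_prime_disjoint {S : Set Form}
    (hdir : ∀ a ∈ S, ∀ b ∈ S, ∃ c ∈ S, Derives Ax ∅ (imp a c) ∧ Derives Ax ∅ (imp b c))
    (h : ∀ s ∈ S, ¬ Derives Ax Γ s) :
    ∃ Δ, Γ ⊆ Δ ∧ IsPrimeTheory Ax Δ ∧ ∀ s ∈ S, s ∉ Δ := by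
  obtain ⟨M, hΓM, hM⟩ := zorn_subset_nonempty {Δ : Set Form | ∀ s ∈ S, ¬ Derives Ax Δ s}
    (by
      intro c hcS hc hne
      refine ⟨⋃₀ c, fun s hs hd => ?_, fun Δ hΔ => Set.subset_sUnion_of_mem hΔ⟩
      obtain ⟨Δ, hΔ, hd⟩ := Derives.exists_of_sUnion hc hne hd
      exact hcS hΔ s hs hd) Γ h
  -- By maximality, a formula outside `M` implies over `M` some member of `S`; closure and primeness
  -- both follow from this.
  have hext : ∀ φ, φ ∉ M → ∃ s ∈ S, Derives Ax M (imp φ s) := by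
    intro φ hφ
    by_contra! hcon
    exact hφ (hM.le_of_ge (y := M ∪ {φ}) (fun s hs hd => hcon s hs hd.deduction)
      Set.subset_union_left (Set.mem_union_right _ rfl))
  refine ⟨M, hΓM, ⟨fun φ hφ => ?_, fun φ ψ hd => ?_⟩, fun s hs hsM => hM.prop s hs (.el hsM)⟩
  · by_contra hcon
    obtain ⟨s, hs, hd⟩ := hext φ hcon
    exact hM.prop s hs (.mp hφ hd)
  · by_contra! hcon
    obtain ⟨s, hs, h₁⟩ := hext φ hcon.1
    obtain ⟨t, ht, h₂⟩ := hext ψ hcon.2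
    obtain ⟨c, hc, hsc, htc⟩ := hdir s hs t ht
    exact hM.prop c hc (.mp (.el hd) (.mp (h₂.imp_trans htc.of_empty)
      (.mp (h₁.imp_trans hsc.of_empty) (.disj_elim _ _ _))))

theorem exists_prime_not_mem (h : ¬ Derives Ax Γ φ) :
    ∃ Δ, Γ ⊆ Δ ∧ IsPrimeTheory Ax Δ ∧ φ ∉ Δ := by
  obtain ⟨Δ, hΓ, hΔ, hφ⟩ := exists_prime_disjoint (Ax := Ax) (Γ := Γ) (S := {φ})
    (by rintro a rfl b rfl; exact ⟨_, rfl, .imp_self _, .imp_self _⟩)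
    (by rintro _ rfl; exact h)
  exact ⟨Δ, hΓ, hΔ, hφ _ rfl⟩

end Calculus

/-! ### Segments -/

section Segments

variable {Ax Γ Δ : Set Form} {φ ψ : Form} {U : Set (Set Form)}

/-- `U` can serve as the set of theories of the modal successors of the theory `Γ`. -/
structure IsTail (Ax Γ : Set Form) (U : Set (Set Form)) : Prop where
  prime : ∀ Δ ∈ U, IsPrimeTheory Ax Δ
  unbox_subset : ∀ Δ ∈ U, unbox Γ ⊆ Δ
  -- Asked of whole theories rather than of single formulas: the frame conditions need a successor
  -- above a given world, not just a witness for one diamond.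
  exists_superset : ∀ Θ, IsTheory Ax Θ → Θ ⊆ undia Γ → ∃ Δ ∈ U, Θ ⊆ Δ
  bot_mem : ∀ Δ ∈ U, bot ∈ Δ → ∀ Δ' ∈ U, bot ∈ Δ'

namespace IsTail

theorem exists_of_dia_mem (hU : IsTail Ax Γ U) (hΓ : IsTheory Ax Γ) (h : dia φ ∈ Γ) :
    ∃ Δ ∈ U, φ ∈ Δ := by
  obtain ⟨Δ, hΔ, hsub⟩ := hU.exists_superset {ψ | Derives Ax {φ} ψ} (.consequences _)
    (fun ψ hψ => hΓ.mem_of_derives h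
      (.dia_mono (Derives.deduction (Derives.mono hψ Set.subset_union_right))))
  exact ⟨Δ, hΔ, hsub (.el rfl)⟩

/-- Ensures that only one segment has an inconsistent head, so that `⊥` holds at the exploding world
alone. -/
theorem eq_singleton_univ (hU : IsTail Ax Set.univ U) : U = {Set.univ} := by
  have h : ∀ Δ ∈ U, Δ = Set.univ :=
    fun Δ hΔ => Set.univ_subset_iff.1 (hU.unbox_subset Δ hΔ)
  obtain ⟨Δ, hΔ, -⟩ := hU.exists_superset Set.univ isPrimeTheory_univ.isTheory
    (fun _ _ => Set.mem_univ _)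
  exact Set.eq_singleton_iff_unique_mem.2 ⟨h Δ hΔ ▸ hΔ, h⟩

theorem univ : IsTail Ax Set.univ {Set.univ} where
  prime := by rintro _ rfl; exact isPrimeTheory_univ
  unbox_subset := by rintro _ rfl; exact Set.subset_univ _
  exists_superset := fun Θ _ _ => ⟨_, rfl, Set.subset_univ Θ⟩
  bot_mem := by rintro _ - - _ rfl; exact Set.mem_univ _

/-- Omitting `φ` makes all members consistent, so `bot_mem` holds vacuously. -/
theorem not_mem (hΓ : IsTheory Ax Γ) (h : dia φ ∉ Γ) :
    IsTail Ax Γ {Δ | IsPrimeTheory Ax Δ ∧ unbox Γ ⊆ Δ ∧ φ ∉ Δ} where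
  prime := fun Δ hΔ => hΔ.1
  unbox_subset := fun Δ hΔ => hΔ.2.1
  exists_superset := by
    intro Θ hΘ hsub
    obtain ⟨Δ, hΔ, hp, hφ⟩ := exists_prime_not_mem (Ax := Ax) (Γ := unbox Γ ∪ Θ) (φ := φ)
      (fun hd => h (hΓ.dia_mem_of_derives hΘ hsub hd))
    exact ⟨Δ, ⟨hp, Set.subset_union_left.trans hΔ, hφ⟩, Set.subset_union_right.trans hΔ⟩
  bot_mem := fun Δ hΔ hb =>
    absurd (hΔ.1.isTheory.mem_of_derives hb (.exfalso φ)) hΔ.2.2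

/-- The largest tail of `Γ`. -/
theorem max (hN : axNDiaBox ∈ Ax) (hΓ : IsTheory Ax Γ) :
    IsTail Ax Γ {Δ | IsPrimeTheory Ax Δ ∧ unbox Γ ⊆ Δ ∧ (bot ∈ Δ → dia bot ∈ Γ)} := by
  by_cases h : dia bot ∈ Γ
  · exact
      { prime := fun Δ hΔ => hΔ.1
        unbox_subset := fun Δ hΔ => hΔ.2.1
        exists_superset := fun Θ _ _ => ⟨Set.univ,
          ⟨isPrimeTheory_univ, Set.subset_univ _, fun _ => h⟩, Set.subset_univ Θ⟩
        -- Here N gives `□⊥ ∈ Γ`, so every member is inconsistent.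
        bot_mem := fun _ _ _ Δ' hΔ' => hΔ'.2.1 (hΓ.box_bot_mem hN h) }
  · simpa only [h, imp_false] using not_mem hΓ h

/-- The smallest tail of `Γ` in the presence of `C◇`. -/
theorem min (hN : axNDiaBox ∈ Ax) (hC : axCDia ∈ Ax) (hΓ : IsPrimeTheory Ax Γ) :
    IsTail Ax Γ {Δ | IsPrimeTheory Ax Δ ∧ unbox Γ ⊆ Δ ∧ Δ ⊆ undia Γ} where
  prime := fun Δ hΔ => hΔ.1
  unbox_subset := fun Δ hΔ => hΔ.2.1
  exists_superset := by
    intro Θ hΘ hsub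
    obtain ⟨Δ, hΔ, hp, hS⟩ := exists_prime_disjoint (Ax := Ax) (Γ := unbox Γ ∪ Θ)
      -- C◇ and primeness of `Γ` close this set under disjunction.
      (S := {s | dia s ∉ Γ})
      (by
        intro a ha b hb
        refine ⟨disj a b, fun hd => ?_, .disj_left _ _, .disj_right _ _⟩
        exact (hΓ.prime _ _ (hΓ.isTheory.mem_of_derives hd
          (.of_mem_axioms hC a b a))).elim ha hb)
      (fun s hs hd => hs (hΓ.isTheory.dia_mem_of_derives hΘ hsub hd))
    exact ⟨Δ, ⟨hp, Set.subset_union_left.trans hΔ,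
      fun φ hφ => by_contra fun hn => hS φ hn hφ⟩, Set.subset_union_right.trans hΔ⟩
  bot_mem := fun Δ hΔ hb Δ' hΔ' => hΔ'.2.1 (hΓ.isTheory.box_bot_mem hN (hΔ.2.2 hb))

end IsTail

/-- In the presence of `I◇□`, a prime theory above a successor of `Γ` is a successor of a theory
above `Γ` that contains all its diamonds. -/
theorem exists_prime_dia (hI : axIDiaBox ∈ Ax) (hΓ : IsTheory Ax Γ) (hΔ : IsPrimeTheory Ax Δ)
    (h : unbox Γ ⊆ Δ) :
    ∃ Γ', IsPrimeTheory Ax Γ' ∧ Γ ⊆ Γ' ∧ unbox Γ' ⊆ Δ ∧ Δ ⊆ undia Γ' := by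
  obtain ⟨Γ', hΓ', hp, hS⟩ := exists_prime_disjoint (Ax := Ax) (Γ := Γ ∪ dia '' Δ)
    (S := box '' Δᶜ)
    (by
      rintro _ ⟨a, ha, rfl⟩ _ ⟨b, hb, rfl⟩
      exact ⟨_, ⟨disj a b, fun hd => (hΔ.prime _ _ hd).elim ha hb, rfl⟩,
        .box_mono (.disj_left _ _), .box_mono (.disj_right _ _)⟩)
    (by
      rintro _ ⟨a, ha, rfl⟩ hd
      -- A derivation of `□a` would put `◇d → □a` in `Γ` for some `d ∈ Δ`; then I◇□ gives `□(d → a)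
      -- ∈ Γ`, hence `a ∈ Δ`.
      obtain ⟨_, ⟨d, hd, rfl⟩, hda⟩ := Derives.deduction_of_directed
        (hΔ.isTheory.nonempty.image dia)
        (by
          rintro _ ⟨b, hb, rfl⟩ _ ⟨c, hc, rfl⟩
          exact ⟨_, ⟨conj b c, hΔ.isTheory.conj_mem.2 ⟨hb, hc⟩, rfl⟩,
            .dia_mono (.conj_left _ _), .dia_mono (.conj_right _ _)⟩) hd
      exact ha (hΔ.isTheory.mem_mp hd (h (hΓ _ (.mp hda (.of_mem_axioms hI d a a))))))
  exact ⟨Γ', hp, Set.subset_union_left.trans hΓ',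
    fun φ hφ => by_contra fun hn => hS _ ⟨φ, hn, rfl⟩ hφ,
    fun φ hφ => hΓ' (.inr ⟨φ, hφ, rfl⟩)⟩

/-- A world of the canonical frame: a prime theory with a tail. -/
structure Segment (Ax : Set Form) : Type u where
  head : Set Form
  tail : Set (Set Form)
  prime : IsPrimeTheory Ax head
  isTail : IsTail Ax head tail

namespace Segment

theorem isTheory (s : Segment.{u} Ax) : IsTheory Ax s.head := s.prime.isTheory

instance : Preorder (Segment.{u} Ax) where
  le s t := s.head ⊆ t.head
  le_refl _ := subset_rfl
  le_trans _ _ _ := Set.Subset.trans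

/-- The inconsistent segment. -/
def expl (Ax : Set Form) : Segment.{u} Ax where
  head := Set.univ
  tail := {Set.univ}
  prime := isPrimeTheory_univ
  isTail := .univ

theorem eq_expl {s : Segment.{u} Ax} (h : bot ∈ s.head) : s = expl Ax := by
  obtain ⟨Γ, U, hΓ, hU⟩ := s
  obtain rfl : Γ = Set.univ := hΓ.isTheory.eq_univ h
  obtain rfl := hU.eq_singleton_univ
  rfl

/-- The segment with the largest tail. -/
def ofPrime (hN : axNDiaBox ∈ Ax) (hΓ : IsPrimeTheory Ax Γ) : Segment.{u} Ax where
  head := Γ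
  tail := _
  prime := hΓ
  isTail := .max hN hΓ.isTheory

end Segment

end Segments

/-! ### The canonical model -/

section Canonical

variable {Ax : Set Form}

/-- The canonical frame. -/
def canonicalFrame (Ax : Set Form) : CKFrame.{u} where
  World := Segment.{u} Ax
  expl := .expl Ax
  R s t := t.head ∈ s.tail
  expl_maximal _ h := Segment.eq_expl (Set.mem_of_subset_of_mem h (Set.mem_univ bot))
  expl_R_iff s := by
    refine ⟨fun h => Segment.eq_expl ?_, by rintro rfl; exact Set.mem_singleton Set.univ⟩
    rw [Set.mem_singleton_iff.1 h]
    exact Set.mem_univ _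

/-- The canonical valuation. -/
def canonicalValuation (Ax : Set Form) : Valuation (canonicalFrame.{u} Ax) where
  val n := {s : Segment.{u} Ax | atom n ∈ s.head}
  upset _ _ _ hst hs := hst hs
  expl_mem n := Set.mem_univ (atom n)

theorem canonicalFrame_nDiaBoxSuff : (canonicalFrame.{u} Ax).NDiaBoxSuff :=
  fun s _ hs ht => Segment.eq_expl (s.isTail.bot_mem _ hs (Set.mem_univ _) _ ht)

theorem canonicalFrame_cDiaSuff (hN : axNDiaBox ∈ Ax) (hC : axCDia ∈ Ax) :
    (canonicalFrame.{u} Ax).CDiaSuff := by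
  intro s
  -- Members of the smallest tail lie in `undia s.head`, hence in `undia y.head` for every `y` above
  -- `s`, so the tail of `y` covers them.
  refine ⟨⟨s.head, _, s.prime, .min hN hC s.prime⟩, Set.Subset.rfl, fun y z hy hz => ?_⟩
  obtain ⟨Δ, hΔ, hsub⟩ := y.isTail.exists_superset z.head z.isTheory (hz.2.2.trans fun _ h => hy h)
  exact ⟨.ofPrime hN (y.isTail.prime Δ hΔ), hΔ, hsub⟩

theorem canonicalFrame_iDiaBoxSuff (hN : axNDiaBox ∈ Ax) (hI : axIDiaBox ∈ Ax) :
    (canonicalFrame.{u} Ax).IDiaBoxSuff := by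
  intro x y z hxy hyz
  obtain ⟨Γ, hΓ, hsub, hbox, hdia⟩ := exists_prime_dia hI x.isTheory z.prime
    ((x.isTail.unbox_subset _ hxy).trans hyz)
  refine ⟨.ofPrime hN hΓ, hsub, ⟨z.prime, hbox, fun h => hdia h⟩, fun s hs => ?_⟩
  obtain ⟨Δ, hΔ, h⟩ := s.isTail.exists_superset z.head z.isTheory (hdia.trans fun _ h => hs h)
  exact ⟨.ofPrime hN (s.isTail.prime Δ hΔ), hΔ, h⟩

theorem forces_canonical_iff (hN : axNDiaBox ∈ Ax) (φ : Form) (s : Segment.{u} Ax) :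
    Forces (canonicalFrame Ax) (canonicalValuation Ax) s φ ↔ φ ∈ s.head := by
  induction φ generalizing s with
  | atom n => exact Iff.rfl
  | bot => exact ⟨fun h => by rw [show s = Segment.expl Ax from h]; exact Set.mem_univ _,
      Segment.eq_expl⟩
  | conj φ ψ ihφ ihψ => exact (and_congr (ihφ s) (ihψ s)).trans s.isTheory.conj_mem.symm
  | disj φ ψ ihφ ihψ =>
    refine (or_congr (ihφ s) (ihψ s)).trans ⟨fun h => ?_, s.prime.prime φ ψ⟩
    exact h.elim (fun h => s.isTheory.mem_of_derives h (.disj_left _ _))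
      (fun h => s.isTheory.mem_of_derives h (.disj_right _ _))
  | imp φ ψ ihφ ihψ =>
    constructor
    · intro h
      by_contra hn
      obtain ⟨Δ, hsub, hΔ, hψ⟩ := exists_prime_not_mem
        (fun hd : Derives Ax (s.head ∪ {φ}) ψ => hn (s.isTheory _ hd.deduction))
      let t : Segment.{u} Ax := .ofPrime hN hΔ
      exact hψ ((ihψ t).1 (h t (Set.subset_union_left.trans hsub)
        ((ihφ t).2 (hsub (.inr rfl)))))
    · exact fun h t hst hφ => (ihψ t).2 (t.isTheory.mem_mp ((ihφ t).1 hφ) (hst h))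
  | box φ ih =>
    constructor
    · intro h
      by_contra hn
      obtain ⟨Δ, hsub, hΔ, hφ⟩ := exists_prime_not_mem
        (fun hd : Derives Ax (unbox s.head) φ => hn (s.isTheory.isTheory_unbox _ hd))
      let t : Segment.{u} Ax := .ofPrime hN hΔ
      -- The tail of `s` itself may lack `Δ`, so the largest tail on the same head is used.
      exact hφ ((ih t).1 (h (.ofPrime hN s.prime) t Set.Subset.rfl
        ⟨hΔ, hsub, fun hb => absurd (hΔ.isTheory.mem_of_derives hb (.exfalso φ)) hφ⟩))
    · exact fun h y z hy hz => (ih z).2 (y.isTail.unbox_subset _ hz (hy h))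
  | dia φ ih =>
    constructor
    · intro h
      by_contra hn
      obtain ⟨z, hz, hφ⟩ := h ⟨s.head, _, s.prime, .not_mem s.isTheory hn⟩ Set.Subset.rfl
      exact hz.2.2 ((ih z).1 hφ)
    · intro h y hy
      obtain ⟨Δ, hΔ, hφ⟩ := y.isTail.exists_of_dia_mem y.isTheory (hy h)
      let z : Segment.{u} Ax := .ofPrime hN (y.isTail.prime Δ hΔ)
      exact ⟨z, hΔ, (ih z).2 hφ⟩

theorem isStronglyComplete_of_canonicalFrame_mem {F : Set CKFrame.{u}} (hN : axNDiaBox ∈ Ax)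
    (hF : canonicalFrame Ax ∈ F) : IsStronglyComplete Ax F := by
  intro Γ φ h
  by_contra hn
  obtain ⟨Δ, hsub, hΔ, hφ⟩ := exists_prime_not_mem hn
  let s : Segment.{u} Ax := .ofPrime hN hΔ
  exact hφ ((forces_canonical_iff hN φ s).1 (h _ hF (canonicalValuation Ax) s
    fun ψ hψ => (forces_canonical_iff hN ψ s).2 (hsub hψ)))

end Canonical

/-! ### Soundness -/

section Soundness

variable {X : CKFrame.{u}} {Ax : Set Form}

theorem forces_expl (V : Valuation X) (φ : Form) : Forces X V X.expl φ := by
  induction φ with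
  | atom n => exact V.expl_mem n
  | bot => exact rfl
  | conj φ ψ ihφ ihψ => exact ⟨ihφ, ihψ⟩
  | disj φ ψ ihφ _ => exact .inl ihφ
  | imp φ ψ _ ihψ => exact fun y hy _ => X.expl_maximal y hy ▸ ihψ
  | box φ ih =>
    intro y z hy hz
    rw [X.expl_maximal y hy, X.expl_R_iff] at hz
    exact hz ▸ ih
  | dia φ ih =>
    intro y hy
    exact ⟨X.expl, X.expl_maximal y hy ▸ (X.expl_R_iff _).2 rfl, ih⟩

theorem Forces.mono {V : Valuation X} {φ : Form} {x y : X.World} (h : Forces X V x φ)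
    (hxy : x ≤ y) : Forces X V y φ := by
  induction φ with
  | atom n => exact V.upset n hxy h
  | bot =>
    obtain rfl : x = X.expl := h
    exact X.expl_maximal y hxy
  | conj φ ψ ihφ ihψ => exact ⟨ihφ h.1, ihψ h.2⟩
  | disj φ ψ ihφ ihψ => exact h.imp ihφ ihψ
  | imp φ ψ _ _ => exact fun z hz => h z (hxy.trans hz)
  | box φ _ => exact fun z w hz => h z w (hxy.trans hz)
  | dia φ _ => exact fun z hz => h z (hxy.trans hz)

theorem forces_of_mem_instances_ckAxioms (V : Valuation X) (x : X.World) {φ : Form}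
    (h : φ ∈ instances ckAxioms) : Forces X V x φ := by
  obtain ⟨χ, hχ, σ, rfl⟩ := h
  rcases hχ with (rfl | rfl | rfl | rfl | rfl | rfl | rfl | rfl | rfl) | rfl | rfl
  · exact fun y _ hy z hz _ => hy.mono hz
  · exact fun y _ hy z hz hz' w hw hw' => hy w (hz.trans hw) hw' w le_rfl (hz' w hw hw')
  · exact fun y _ hy => hy.1
  · exact fun y _ hy => hy.2
  · exact fun y _ hy z hz hz' => ⟨hy.mono hz, hz'⟩
  · exact fun y _ hy => .inl hy
  · exact fun y _ hy => .inr hy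
  · exact fun y _ hy z hz hz' w hw hw' => hw'.elim (hy w (hz.trans hw)) (hz' w hw)
  · rintro y - rfl
    exact forces_expl V _
  · exact fun y _ hy z hz hz' v w hv hw => hy v w (hz.trans hv) hw w le_rfl (hz' v w hv hw)
  · intro y _ hy z hz hz' v hv
    obtain ⟨w, hw, hw'⟩ := hz' v hv
    exact ⟨w, hw, hy v w (hz.trans hv) hw w le_rfl hw'⟩

theorem CKFrame.CDiaSuff.forces (hX : X.CDiaSuff) (V : Valuation X) (x : X.World)
    (σ : ℕ → Form) : Forces X V x (axCDia.subst σ) := by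
  intro y _ hy
  obtain ⟨y', hyy', hw⟩ := hX y
  -- The disjunct true at this single `z` is chosen for all worlds above `y`.
  obtain ⟨z, hz, hz'⟩ := hy y' hyy'
  refine hz'.imp (fun h v hv => ?_) (fun h v hv => ?_) <;>
  · obtain ⟨w, hw, hzw⟩ := hw v z hv hz
    exact ⟨w, hw, h.mono hzw⟩

theorem CKFrame.IDiaBoxSuff.forces (hX : X.IDiaBoxSuff) (V : Valuation X) (x : X.World)
    (σ : ℕ → Form) : Forces X V x (axIDiaBox.subst σ) := by
  intro y _ hy v w hv hw z hz hz'
  obtain ⟨s, hs, hsz, ht⟩ := hX v w z hw hz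
  -- The world `s` forces `◇p`, as every world above it sees one above `z`; hence it forces `□q`,
  -- and it sees `z`.
  refine hy s (hv.trans hs) (fun s' hs' => ?_) s z le_rfl hsz
  obtain ⟨t, hst, hzt⟩ := ht s' hs'
  exact ⟨t, hst, hz'.mono hzt⟩

theorem CKFrame.NDiaBoxCorr.forces (hX : X.NDiaBoxCorr) (V : Valuation X) (x : X.World)
    (σ : ℕ → Form) : Forces X V x (axNDiaBox.subst σ) := by
  intro y _ hy
  refine hX y fun z hz => ?_
  obtain ⟨w, hw, rfl⟩ := hy z hz
  exact hw

theorem CKFrame.NDiaBoxSuff.nDiaBoxCorr (hX : X.NDiaBoxSuff) : X.NDiaBoxCorr :=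
  fun _ h y z hy hz => hX y z (h y hy) hz

theorem Derives.forces {Γ : Set Form} {φ : Form}
    (hX : ∀ χ ∈ Ax, ∀ (V : Valuation X) (x : X.World) (σ : ℕ → Form), Forces X V x (χ.subst σ))
    (h : Derives Ax Γ φ) : X.Validates Γ φ := by
  intro V x hx
  induction h generalizing x with
  | ax h =>
    rcases h with h | ⟨χ, hχ, σ, rfl⟩
    · exact forces_of_mem_instances_ckAxioms V x h
    · exact hX χ hχ V x σ
  | mp _ _ ih₁ ih₂ => exact ih₂ x hx x le_rfl (ih₁ x hx)
  | nec _ ih => exact fun _ z _ _ => ih z (fun _ h => h.elim)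
  | el h => exact hx _ h

theorem validates_of_suff {Γ : Set Form} {φ : Form} (hAx : Ax ⊆ {axCDia, axIDiaBox})
    (hN : X.NDiaBoxCorr) (hX : X.SatisfiesSuff Ax) (h : Derives (Ax ∪ {axNDiaBox}) Γ φ) :
    X.Validates Γ φ := by
  refine h.forces ?_
  rintro χ (hχ | rfl)
  · rcases hAx hχ with rfl | rfl
    · exact (hX.1 hχ).forces
    · exact (hX.2 hχ).forces
  · exact hN.forces

end Soundness

theorem canonicalFrame_satisfiesSuff (Ax : Set Form) :
    (canonicalFrame.{u} (Ax ∪ {axNDiaBox})).SatisfiesSuff Ax :=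
  ⟨fun h => canonicalFrame_cDiaSuff (.inr rfl) (.inl h),
    fun h => canonicalFrame_iDiaBoxSuff (.inr rfl) (.inl h)⟩

end CKLogic

theorem mainTheorem7 (Ax : Set CKLogic.Form)
    (hAx : Ax ⊆ {CKLogic.axCDia, CKLogic.axIDiaBox}) :
    (CKLogic.IsSound (Ax ∪ {CKLogic.axNDiaBox})
        {X : CKLogic.CKFrame.{u} | X.NDiaBoxCorr ∧ X.SatisfiesSuff Ax} ∧
      CKLogic.IsStronglyComplete (Ax ∪ {CKLogic.axNDiaBox})
        {X : CKLogic.CKFrame.{u} | X.NDiaBoxCorr ∧ X.SatisfiesSuff Ax}) ∧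
    (CKLogic.axIDiaBox ∈ Ax →
      CKLogic.IsSound (Ax ∪ {CKLogic.axNDiaBox})
        {X : CKLogic.CKFrame.{u} | X.NDiaBoxSuff ∧ X.SatisfiesSuff Ax} ∧
      CKLogic.IsStronglyComplete (Ax ∪ {CKLogic.axNDiaBox})
        {X : CKLogic.CKFrame.{u} | X.NDiaBoxSuff ∧ X.SatisfiesSuff Ax}) := by
  have hcan := CKLogic.canonicalFrame_satisfiesSuff.{u} Ax
  have hN := CKLogic.canonicalFrame_nDiaBoxSuff.{u} (Ax := Ax ∪ {CKLogic.axNDiaBox})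
  exact ⟨⟨fun _ _ h _ hX => CKLogic.validates_of_suff hAx hX.1 hX.2 h,
      CKLogic.isStronglyComplete_of_canonicalFrame_mem (.inr rfl) ⟨hN.nDiaBoxCorr, hcan⟩⟩,
    fun _ => ⟨fun _ _ h _ hX => CKLogic.validates_of_suff hAx hX.1.nDiaBoxCorr hX.2 h,
      CKLogic.isStronglyComplete_of_canonicalFrame_mem (.inr rfl) ⟨hN, hcan⟩⟩⟩
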